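/- **Theorem (Exact manifest transfer function identification for acyclic latent subnetworks, LSAR version).** Consider the linear network $$\begin{bmatrix}x_m(k+1)\\ x_l(k+1)\end{bmatrix}=A\begin{bmatrix}x_m(k)\\ x_l(k)\end{bmatrix}+\begin{bmatrix}u_m(k)\\ 0\end{bmatrix},\qquad A=\begin{bmatrix}A_{11}&A_{12}\\A_{21}&A_{22}\end{bmatrix},\qquad y(k)=x_m(k),\qquad k\ge 0,$$ with $n_m$ manifest and $n_l$ passive latent nodes, real matrices, spectral radii $\rho(A)<1$ and $\rho(A_{22})<1$, and an arbitrary (possibly random) initial state $x(0)$. Let the inputs $u_m(k)\in\mathbb R^{n_m}$ be i.i.d. absolutely continuous random vectors with zero mean and covariance $I_{n_m}$. Let the manifest transfer function $T_{x_mu_m}(\omega)$ be the manifest (upper left) $n_m\times n_m$ block of $(e^{j\omega}I-A)^{-1}$. For $\tau\ge 1$ and $N>\tau$, let $[\hat A_0\ \cdots\ \hat A_{\tau-1}]=\vec y_N\Phi_N^{+}$ be the (minimum-norm) least-squares auto-regressive (LSAR) estimate of order $\tau$ from the data $y(1),\dots,y(N)$, where $\vec y_N=[y(\tau+1)\ \cdots\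 y(N)]$, $\Phi_N$ has block rows $[y(\tau-i)\ \cdots\ y(N-1-i)]$, $i=0,\dots,\tau-1$, and $(\cdot)^+$ is the Moore–Penrose pseudoinverse. Let $$T_{ye}(\{y\}_1^N,\tau)(\omega)=\Big(zI_{n_m}-\sum_{i=0}^{\tau-1}z^{-i}\hat A_i\Big)^{-1},\qquad z=e^{j\omega},$$ be the transfer function from $e$ to $y$ of the estimated model $y(k+1)=\sum_{i=0}^{\tau-1}\hat A_iy(k-i)+e(k)$. Assume that $A_{22}$ is nilpotent, $A_{22}^{\tau_{22}}=0$ with $\tau_{22}\ge 1$. Then for every $\tau\ge\tau_{22}+1$, $$\operatorname*{plim}_{N\to\infty}T_{ye}(\{y\}_1^N,\tau)=T_{x_mu_m}.$$ That is: the probability that the inverse defining $T_{ye}(\{y\}_1^N,\tau)(\omega)$ exists for all $\omega\in[-\pi,\pi]$ tends to $1$; for each $\omega\in[-\pi,\pi]$, every entry of $T_{ye}(\{y\}_1^N,\tau)(\omega)$ converges in probability to the corresponding entry of $T_{x_mu_m}(\omega)$; and $\|T_{ye}(\{y\}_1^N,\tau)-T_{x_mu_m}\|_\infty\to 0$ in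 probability, where $\|T\|_\infty=\sup_{-\pi\le\omega\le\pi}\|T(\omega)\|$ with the spectral norm. -/

import Mathlib

open MeasureTheory ProbabilityTheory Filter Topology
open scoped Matrix ENNReal

noncomputable section

namespace LSAR

/-! ### Moore-Penrose pseudoinverse of a real matrix -/

/-- `X` satisfies the four Penrose equations for `M`, i.e. `X` is the Moore-Penrose
pseudoinverse of the real matrix `M`. -/
def IsMoorePenrose {p q : Type*} [Fintype p] [Fintype q]
    (M : Matrix p q ℝ) (X : Matrix q p ℝ) : Prop :=
  M * X * M = M ∧ X * M * X = X ∧ (M * X)ᵀ = M * X ∧ (X * M)ᵀ = X * M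

theorem exists_isMoorePenrose {p q : Type*} [Fintype p] [Fintype q]
    (M : Matrix p q ℝ) : ∃ X, IsMoorePenrose M X := by
  classical
  have hH : (M * Mᵀ).IsHermitian := by
    simp [Matrix.IsHermitian, Matrix.conjTranspose_eq_transpose_of_trivial]
  obtain ⟨K, h1, h2, h3, h4⟩ : ∃ K : Matrix p p ℝ, (M * Mᵀ) * K * (M * Mᵀ) = M * Mᵀ ∧
      K * (M * Mᵀ) * K = K ∧ Kᵀ = K ∧ (M * Mᵀ) * K = K * (M * Mᵀ) := by
    generalize M * Mᵀ = H at hH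
    obtain ⟨U, d, hU, hd⟩ : ∃ (U : Matrix p p ℝ) (d : p → ℝ), Uᵀ * U = 1 ∧
        H = U * Matrix.diagonal d * Uᵀ := by
      refine ⟨hH.eigenvectorUnitary, hH.eigenvalues, ?_, ?_⟩
      · have := Unitary.coe_star_mul_self hH.eigenvectorUnitary
        simpa [Matrix.star_eq_conjTranspose,
          Matrix.conjTranspose_eq_transpose_of_trivial] using this
      · have := hH.spectral_theorem
        simpa [Unitary.conjStarAlgAut_apply, Matrix.star_eq_conjTranspose, Function.comp_def,
          Matrix.conjTranspose_eq_transpose_of_trivial] using this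
    have key : ∀ a b : p → ℝ, (U * Matrix.diagonal a * Uᵀ) * (U * Matrix.diagonal b * Uᵀ) =
        U * Matrix.diagonal (fun i => a i * b i) * Uᵀ := by
      intro a b
      calc (U * Matrix.diagonal a * Uᵀ) * (U * Matrix.diagonal b * Uᵀ)
          = U * Matrix.diagonal a * (Uᵀ * U) * Matrix.diagonal b * Uᵀ := by
            simp only [Matrix.mul_assoc]
        _ = _ := by rw [hU, Matrix.mul_one, Matrix.mul_assoc U, Matrix.diagonal_mul_diagonal]
    refine ⟨U * Matrix.diagonal (fun i => (d i)⁻¹) * Uᵀ, ?_, ?_, ?_, ?_⟩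
    · rw [hd, key, key]
      simp only [mul_inv_mul_cancel]
    · rw [hd, key, key]
      have h : (fun i => (d i)⁻¹ * d i * (d i)⁻¹) = fun i => (d i)⁻¹ := by
        funext i
        simpa using mul_inv_mul_cancel (d i)⁻¹
      rw [h]
    · simp [Matrix.mul_assoc]
    · rw [hd, key, key]; simp [mul_comm]
  have hz : M * (Mᵀ * K) * M = M := by
    have h0 : (M * Mᵀ * K - 1) * M = 0 := by
      have : ((M * Mᵀ * K - 1) * M) * ((M * Mᵀ * K - 1) * M)ᵀ = 0 := by
        rw [Matrix.transpose_mul, Matrix.mul_assoc, ← Matrix.mul_assoc M, ← Matrix.mul_assoc,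
          Matrix.sub_mul, h1, Matrix.one_mul, sub_self, Matrix.zero_mul]
      rw [← Matrix.conjTranspose_eq_transpose_of_trivial] at this
      exact Matrix.self_mul_conjTranspose_eq_zero.mp this
    rw [Matrix.sub_mul, Matrix.one_mul, sub_eq_zero] at h0
    rw [← Matrix.mul_assoc]; exact h0
  refine ⟨Mᵀ * K, hz, ?_, ?_, ?_⟩
  · have : Mᵀ * K * M * (Mᵀ * K) = Mᵀ * (K * (M * Mᵀ) * K) := by simp only [Matrix.mul_assoc]
    rw [this, h2]
  · rw [← Matrix.mul_assoc, Matrix.transpose_mul, h3, h4]; simp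
  · simp [h3, Matrix.mul_assoc]

/-- The Moore-Penrose pseudoinverse of a real matrix. -/
def pinv {p q : Type*} [Fintype p] [Fintype q] (M : Matrix p q ℝ) : Matrix q p ℝ :=
  Classical.choose (exists_isMoorePenrose M)

theorem pinv_spec {p q : Type*} [Fintype p] [Fintype q] (M : Matrix p q ℝ) :
    IsMoorePenrose M (pinv M) :=
  Classical.choose_spec (exists_isMoorePenrose M)

/-! ### The network with manifest nodes `Fin nm` and passive latent nodes `Fin nl` -/

/-- A real square matrix is Schur stable if its (complex) spectral radius is less than `1`. -/
def SchurStable {ι : Type*} [Fintype ι] [DecidableEq ι] (M : Matrix ι ι ℝ) : Prop :=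
  spectralRadius ℂ (M.map (algebraMap ℝ ℂ)) < 1

/-- State `x(k)` of the network `x(k+1) = A x(k) + [u_m(k); 0]` with initial state `x₀`. -/
def state {nm nl : ℕ} (A : Matrix (Fin nm ⊕ Fin nl) (Fin nm ⊕ Fin nl) ℝ)
    (x₀ : Fin nm ⊕ Fin nl → ℝ) (um : ℕ → Fin nm → ℝ) : ℕ → Fin nm ⊕ Fin nl → ℝ
  | 0 => x₀
  | k + 1 => A *ᵥ state A x₀ um k + Sum.elim (um k) 0

/-- Measured output `y(k) = x_m(k)`. -/
def output {nm nl : ℕ} (A : Matrix (Fin nm ⊕ Fin nl) (Fin nm ⊕ Fin nl) ℝ)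
    (x₀ : Fin nm ⊕ Fin nl → ℝ) (um : ℕ → Fin nm → ℝ) (k : ℕ) : Fin nm → ℝ :=
  fun i => state A x₀ um k (Sum.inl i)

/-- The input is a sequence of i.i.d., absolutely continuous, square integrable random vectors
with zero mean and identity covariance. -/
structure IsWhiteInput {Ω : Type*} [MeasurableSpace Ω] (P : Measure Ω) {nm : ℕ}
    (um : ℕ → Ω → Fin nm → ℝ) : Prop where
  measurable : ∀ k, Measurable (um k)
  indep : iIndepFun um P
  identDistrib : ∀ k, IdentDistrib (um k) (um 0) P P
  absolutelyContinuous : ∀ k, P.map (um k) ≪ volume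
  memLp : ∀ k i, MemLp (fun s => um k s i) 2 P
  mean : ∀ k i, ∫ s, um k s i ∂P = 0
  cov : ∀ k i j, covariance (fun s => um k s i) (fun s => um k s j) P =
    (1 : Matrix (Fin nm) (Fin nm) ℝ) i j

/-! ### Least-squares auto-regressive estimation -/

/-- The matrix `[y(τ+1) y(τ+2) ⋯ y(N)]`. -/
def yMat {nm : ℕ} (τ N : ℕ) (y : ℕ → Fin nm → ℝ) : Matrix (Fin nm) (Fin (N - τ)) ℝ :=
  Matrix.of fun a c => y (τ + 1 + c) a

/-- The regressor matrix `Φ_N`: its block row `i ∈ {0, …, τ-1}` is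
`[y(τ-i) y(τ-i+1) ⋯ y(N-1-i)]`. -/
def regressor {nm : ℕ} (τ N : ℕ) (y : ℕ → Fin nm → ℝ) :
    Matrix (Fin τ × Fin nm) (Fin (N - τ)) ℝ :=
  Matrix.of fun r c => y (τ + c - r.1) r.2

/-- The LSAR estimate `[Â₀ Â₁ ⋯ Â_{τ-1}]`, the minimum-norm least-squares solution
`[y(τ+1) ⋯ y(N)] Φ_N⁺`. -/
def lsar {nm : ℕ} (τ N : ℕ) (y : ℕ → Fin nm → ℝ) : Matrix (Fin nm) (Fin τ × Fin nm) ℝ :=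
  yMat τ N y * pinv (regressor τ N y)

/-- The block `Âᵢ` of the LSAR estimate. -/
def lsarCoeff {nm : ℕ} (τ N : ℕ) (y : ℕ → Fin nm → ℝ) (i : Fin τ) :
    Matrix (Fin nm) (Fin nm) ℝ :=
  Matrix.of fun a b => lsar τ N y a (i, b)

/-! ### Transfer functions on the unit circle -/

/-- The point `z = e^{jθ}`. -/
def zPoint (θ : ℝ) : ℂ := Complex.exp (Complex.I * θ)

/-- The manifest transfer function `T_{x_m u_m}(θ)`: the manifest block of the transfer function
`(zI - A)⁻¹` of the whole network. -/
def manifestTF {nm nl : ℕ} (A : Matrix (Fin nm ⊕ Fin nl) (Fin nm ⊕ Fin nl) ℝ) (θ : ℝ) :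
    Matrix (Fin nm) (Fin nm) ℂ :=
  ((zPoint θ • (1 : Matrix (Fin nm ⊕ Fin nl) (Fin nm ⊕ Fin nl) ℂ) -
    A.map (algebraMap ℝ ℂ))⁻¹).toBlocks₁₁

/-- The matrix `zI - ∑_{i<τ} z^{-i} Bᵢ` at `z = e^{jθ}`. -/
def arChar {nm τ : ℕ} (B : Fin τ → Matrix (Fin nm) (Fin nm) ℝ) (θ : ℝ) :
    Matrix (Fin nm) (Fin nm) ℂ :=
  zPoint θ • (1 : Matrix (Fin nm) (Fin nm) ℂ) -
    ∑ i : Fin τ, (zPoint θ ^ (i : ℕ))⁻¹ • (B i).map (algebraMap ℝ ℂ)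

/-- Transfer function from `e` to `y` of the auto-regressive model
`y(k+1) = ∑_{i<τ} Bᵢ y(k-i) + e(k)`. -/
def arTF {nm τ : ℕ} (B : Fin τ → Matrix (Fin nm) (Fin nm) ℝ) (θ : ℝ) :
    Matrix (Fin nm) (Fin nm) ℂ :=
  (arChar B θ)⁻¹

open scoped Matrix.Norms.L2Operator in
/-- The `H_∞`-norm `sup_{-π ≤ θ ≤ π} ‖T(θ)‖` (spectral norm), with value `∞` if unbounded. -/
def hInfNorm {nm : ℕ} (T : ℝ → Matrix (Fin nm) (Fin nm) ℂ) : ℝ≥0∞ :=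
  ⨆ θ ∈ Set.Icc (-Real.pi) Real.pi, ‖T θ‖ₑ

end LSAR

end

/-!
Since `A₂₂ ^ t = 0`, the latent state is a finite moving average of past outputs, so for `k ≥ t` the
output satisfies the exact auto-regressive model
`y(k+1) = A₁₁ y(k) + ∑_{j<t} A₁₂ A₂₂ʲ A₂₁ y(k-1-j) + u(k)`. By the Schur complement, and because
`∑_{j<t} z^{-j-1} A₂₂ʲ = (zI - A₂₂)⁻¹`, the transfer function of this model is the manifest one. It
remains to see that the least-squares estimate converges in probability to these coefficients.

The normal equations read `(Θ̂ - Θ) G = S`, where `G` is the empirical Gram matrix of the regressors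
`φ(k)` and `S` the empirical cross moment of noise and regressors. The products of `u(k)` with
functions of the past are orthogonal with bounded second moments, so `S → 0`. For the lower bound on
`G`, write the model in companion form `φ(k+1) = F φ(k) + L u(k)`: up to a vanishing error
`G ≥ F G Fᵀ + L Γ Lᵀ`, and iterating this inequality shows that `G` dominates the Gramian
`∑_{i<m} Fⁱ L Γ Lᵀ (Fᵀ)ⁱ`, which is positive definite because `(F, L)` is reachable.

Convergence in probability to a constant is convergence along a filter on `ℕ × Ω`, so the
deterministic estimates and the continuity of `(zI - ∑ z^{-i} Bᵢ)⁻¹` in the coefficients apply to it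
directly.
-/

noncomputable section

namespace LSAR

open scoped MatrixOrder

section ConvergenceInMeasure

variable {Ω ι κ : Type*} [MeasurableSpace Ω] {P : Measure Ω} {l : Filter ι}

/-- The filter on `ι × Ω` of the sets whose sections `{s | (n, s) ∈ S}` have a complement of
measure tending to `0` along `l`. Convergence in measure to a constant is convergence along this
filter, so continuity arguments apply to it verbatim. -/
def inMeasure (P : Measure Ω) (l : Filter ι) : Filter (ι × Ω) where
  sets := {S | Tendsto (fun n => P {s | (n, s) ∉ S}) l (𝓝 0)}
  univ_sets := by simp [tendsto_const_nhds]
  sets_of_superset hS hST := tendsto_of_tendsto_of_tendsto_of_le_of_le tendsto_const_nhds hS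
    (fun _ => zero_le) fun _ => measure_mono fun _ hs h => hs (hST h)
  inter_sets hS hT := by
    refine tendsto_of_tendsto_of_tendsto_of_le_of_le tendsto_const_nhds
      (by simpa using Tendsto.add hS hT) (fun _ => zero_le)
      fun n => (measure_mono fun s hs => ?_).trans (measure_union_le _ _)
    exact not_and_or.1 hs

theorem eventually_inMeasure {p : ι × Ω → Prop} :
    (∀ᶠ q in inMeasure P l, p q) ↔ Tendsto (fun n => P {s | ¬ p (n, s)}) l (𝓝 0) :=
  Iff.rfl

theorem tendstoInMeasure_const_iff {E : Type*} [PseudoEMetricSpace E] {f : ι → Ω → E} {a : E} :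
    TendstoInMeasure P f l (fun _ => a) ↔
      Tendsto (fun q : ι × Ω => f q.1 q.2) (inMeasure P l) (𝓝 a) := by
  simp only [EMetric.tendsto_nhds, eventually_inMeasure, not_lt, TendstoInMeasure]

theorem tendsto_prodMap_inMeasure {l' : Filter κ} {k : κ → ι} (hk : Tendsto k l' l) :
    Tendsto (Prod.map k id) (inMeasure P l') (inMeasure P l) :=
  fun S hS => Tendsto.comp (g := fun n => P {s | (n, s) ∉ S}) hS hk

theorem tendsto_inMeasure_of_tendsto_ae [IsFiniteMeasure P] {E : Type*} [PseudoEMetricSpace E]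
    {f : ℕ → Ω → E} {a : E} (hf : ∀ n, AEStronglyMeasurable (f n) P)
    (h : ∀ᵐ s ∂P, Tendsto (fun n => f n s) atTop (𝓝 a)) :
    Tendsto (fun q : ℕ × Ω => f q.1 q.2) (inMeasure P atTop) (𝓝 a) :=
  tendstoInMeasure_const_iff.1 (tendstoInMeasure_of_tendsto_ae hf h)

theorem tendsto_inMeasure_of_tendsto_integral_sq {f : ι → Ω → ℝ} (hf : ∀ n, MemLp (f n) 2 P)
    (h : Tendsto (fun n => ∫ s, f n s ^ 2 ∂P) l (𝓝 0)) :
    Tendsto (fun q : ι × Ω => f q.1 q.2) (inMeasure P l) (𝓝 0) := by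
  have hnorm (n : ι) : eLpNorm (f n - fun _ => 0) 2 P =
      ENNReal.ofReal (√(∫ s, f n s ^ 2 ∂P)) := by
    have := (hf n).eLpNorm_eq_integral_rpow_norm two_ne_zero ENNReal.ofNat_ne_top
    simpa [Real.sqrt_eq_rpow, Pi.sub_def] using this
  refine tendstoInMeasure_const_iff.1 (tendstoInMeasure_of_tendsto_eLpNorm two_ne_zero
    (fun n => (hf n).aestronglyMeasurable) aestronglyMeasurable_const ?_)
  simpa only [hnorm, Real.sqrt_zero, ENNReal.ofReal_zero] using ENNReal.tendsto_ofReal h.sqrt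

end ConvergenceInMeasure

section Gramian

/-- The controllability Gramian `∑_{j<m} fʲ d (fʲ)⋆` over the horizon `m`. -/
def gramian {α : Type*} [Semiring α] [StarRing α] (m : ℕ) (f d : α) : α :=
  ∑ j ∈ Finset.range m, f ^ j * d * star (f ^ j)

theorem gramian_le {α : Type*} [Semiring α] [PartialOrder α] [StarRing α] [StarOrderedRing α]
    {f g d : α} (hg : 0 ≤ g) (h : f * g * star f + d ≤ g) (m : ℕ) : gramian m f d ≤ g := by
  suffices hstep : f ^ m * g * star (f ^ m) + gramian m f d ≤ g from
    (le_add_of_nonneg_left (star_right_conjugate_nonneg hg _)).trans hstep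
  induction m with
  | zero => simp [gramian]
  | succ m ih =>
    calc f ^ (m + 1) * g * star (f ^ (m + 1)) + gramian (m + 1) f d
        = f ^ m * (f * g * star f + d) * star (f ^ m) + gramian m f d := by
          simp only [gramian, Finset.sum_range_succ, pow_succ, star_mul, mul_add, add_mul,
            mul_assoc]
          abel
      _ ≤ f ^ m * g * star (f ^ m) + gramian m f d := by
          gcongr
          exact star_right_conjugate_le_conjugate h _
      _ ≤ g := ih

theorem isSelfAdjoint_gramian {α : Type*} [Semiring α] [StarRing α] {d : α}
    (hd : IsSelfAdjoint d) (m : ℕ) (f : α) : IsSelfAdjoint (gramian m f d) :=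
  isSelfAdjoint_sum _ fun _ _ => hd.conjugate _

theorem continuous_gramian {α : Type*} [Semiring α] [StarRing α] [TopologicalSpace α]
    [ContinuousAdd α] [ContinuousMul α] (m : ℕ) (f : α) : Continuous (gramian m f) := by
  unfold gramian
  fun_prop

variable {ι R : Type*} [Fintype ι] [Fintype R] [DecidableEq R]

/-- The pair `(F, L)` of the recursion `φ(k+1) = F φ(k) + L u(k)` is reachable in `m` steps, in the
dual form: no nonzero row vector annihilates all of `L, F L, …, Fᵐ⁻¹ L`. -/
def IsReachable (m : ℕ) (F : Matrix R R ℝ) (L : Matrix R ι ℝ) : Prop :=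
  ∀ v : R → ℝ, (∀ j < m, v ᵥ* (F ^ j * L) = 0) → v = 0

theorem IsReachable.posDef_gramian {m : ℕ} {F : Matrix R R ℝ} {L : Matrix R ι ℝ}
    (hFL : IsReachable m F L) {Γ : Matrix ι ι ℝ} (hΓ : Γ.PosDef) :
    (gramian m F (L * Γ * Lᵀ)).PosDef := by
  have hterm (j : ℕ) : F ^ j * (L * Γ * Lᵀ) * star (F ^ j) = F ^ j * L * Γ * (F ^ j * L)ᴴ := by
    simp only [Matrix.star_eq_conjTranspose, Matrix.conjTranspose_eq_transpose_of_trivial,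
      Matrix.transpose_mul, Matrix.mul_assoc]
  have hpsd (j : ℕ) : (F ^ j * L * Γ * (F ^ j * L)ᴴ).PosSemidef :=
    hΓ.posSemidef.mul_mul_conjTranspose_same _
  simp only [gramian, hterm]
  refine .of_dotProduct_mulVec_pos (Matrix.posSemidef_sum _ fun j _ => hpsd j).isHermitian
    fun v hv => ?_
  obtain ⟨j, hj, hvj⟩ : ∃ j < m, v ᵥ* (F ^ j * L) ≠ 0 := by
    by_contra! h
    exact hv (hFL v h)
  rw [Matrix.sum_mulVec, dotProduct_sum]
  refine Finset.sum_pos' (fun i _ => (hpsd i).dotProduct_mulVec_nonneg v)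
    ⟨j, Finset.mem_range.2 hj, ?_⟩
  have h := hΓ.dotProduct_mulVec_pos hvj
  rw [star_trivial, Matrix.dotProduct_mulVec] at h ⊢
  rwa [← Matrix.vecMul_vecMul, ← Matrix.vecMul_vecMul, ← Matrix.dotProduct_mulVec,
    Matrix.conjTranspose_eq_transpose_of_trivial, Matrix.mulVec_transpose]

open scoped Matrix.Norms.L2Operator in
theorem exists_eventually_smul_one_le {R : Type*} [Finite R] [DecidableEq R] {Q : Matrix R R ℝ}
    (hQ : Q.PosDef) : ∃ c > (0 : ℝ), ∀ᶠ X in 𝓝 Q, X.IsHermitian → c • (1 : Matrix R R ℝ) ≤ X := by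
  have := Fintype.ofFinite R
  cases isEmpty_or_nonempty R
  · exact ⟨1, one_pos, .of_forall fun _ _ => (Subsingleton.elim _ _).le⟩
  obtain ⟨r, hr, hrQ⟩ := (CFC.exists_pos_algebraMap_le_iff hQ.isHermitian).2
    fun x hx => hQ.isStrictlyPositive.spectrum_pos hx
  refine ⟨r / 2, half_pos hr, ?_⟩
  filter_upwards [Metric.ball_mem_nhds Q (half_pos hr)] with X hX hXh
  have hdiff : algebraMap ℝ _ (-(r / 2)) ≤ X - Q :=
    algebraMap_le_of_le_spectrum (fun x hx => neg_le_of_abs_le <|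
      (spectrum.norm_le_norm_of_mem hx).trans (mem_ball_iff_norm.1 hX).le) (hXh.sub hQ.isHermitian)
  have h := add_le_add hrQ hdiff
  rwa [← map_add, ← sub_eq_add_neg, sub_half, add_sub_cancel, Algebra.algebraMap_eq_smul_one] at h

end Gramian

section CrossMoment

variable {ι κ R : Type*}

/-- The matrix with columns `x(0), …, x(n-1)`. -/
def dataMatrix (n : ℕ) (x : ℕ → R → ℝ) : Matrix R (Fin n) ℝ :=
  Matrix.of fun r c => x c r

/-- The empirical cross moment `n⁻¹ ∑_{c<n} u(c) φ(c)ᵀ` of two vector sequences, with value `0` for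
`n = 0`. -/
def crossMoment (n : ℕ) (u : ℕ → ι → ℝ) (φ : ℕ → κ → ℝ) : Matrix ι κ ℝ :=
  (n : ℝ)⁻¹ • (dataMatrix n u * (dataMatrix n φ)ᵀ)

theorem crossMoment_apply (n : ℕ) (u : ℕ → ι → ℝ) (φ : ℕ → κ → ℝ) (a : ι) (r : κ) :
    crossMoment n u φ a r = (∑ c ∈ Finset.range n, u c a * φ c r) / n := by
  simp [crossMoment, dataMatrix, Matrix.mul_apply, Finset.sum_range, div_eq_inv_mul]

theorem posSemidef_crossMoment_self [Finite R] (n : ℕ) (φ : ℕ → R → ℝ) :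
    (crossMoment n φ φ).PosSemidef := by
  rw [crossMoment, ← Matrix.conjTranspose_eq_transpose_of_trivial]
  exact (Matrix.posSemidef_self_mul_conjTranspose _).smul (by positivity)

theorem crossMoment_shift_self_le [Finite R] (n : ℕ) (φ : ℕ → R → ℝ) :
    crossMoment n (fun c => φ (c + 1)) (fun c => φ (c + 1)) ≤
      crossMoment n φ φ + Matrix.vecMulVec ((√n)⁻¹ • φ n) ((√n)⁻¹ • φ n) := by
  have htelescope : crossMoment n φ φ + Matrix.vecMulVec ((√n)⁻¹ • φ n) ((√n)⁻¹ • φ n) -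
      crossMoment n (fun c => φ (c + 1)) (fun c => φ (c + 1)) =
        Matrix.vecMulVec ((√n)⁻¹ • φ 0) ((√n)⁻¹ • φ 0) := by
    ext r r'
    have hsqrt : (√n)⁻¹ * (√n)⁻¹ = (n : ℝ)⁻¹ := by
      rw [← mul_inv, Real.mul_self_sqrt n.cast_nonneg]
    have hsum := (Finset.sum_range_succ (fun c => φ c r * φ c r') n).symm.trans
      (Finset.sum_range_succ' (fun c => φ c r * φ c r') n)
    simp only [Matrix.sub_apply, Matrix.add_apply, crossMoment_apply, Matrix.vecMulVec_apply,
      Pi.smul_apply, smul_eq_mul]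
    linear_combination (n : ℝ)⁻¹ * hsum + (φ n r * φ n r' - φ 0 r * φ 0 r') * hsqrt
  rw [Matrix.le_iff, htelescope]
  exact Matrix.posSemidef_vecMulVec_self_star _

variable [Fintype ι] [Fintype R] {F : Matrix R R ℝ} {L : Matrix R ι ℝ}

theorem crossMoment_shift_self_eq {φ : ℕ → R → ℝ} {u : ℕ → ι → ℝ}
    (hrec : ∀ c, φ (c + 1) = F *ᵥ φ c + L *ᵥ u c) (n : ℕ) :
    crossMoment n (fun c => φ (c + 1)) (fun c => φ (c + 1)) =
      F * crossMoment n φ φ * Fᵀ + F * (crossMoment n u φ)ᵀ * Lᵀ +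
        L * crossMoment n u φ * Fᵀ + L * crossMoment n u u * Lᵀ := by
  have hdata : dataMatrix n (fun c => φ (c + 1)) = F * dataMatrix n φ + L * dataMatrix n u := by
    ext r c
    simp [dataMatrix, hrec, Matrix.mulVec, dotProduct, Matrix.mul_apply]
  simp only [crossMoment, hdata, Matrix.transpose_add, Matrix.transpose_mul, Matrix.mul_add,
    Matrix.add_mul, smul_add, Matrix.mul_smul, Matrix.smul_mul, Matrix.transpose_smul,
    Matrix.transpose_transpose, Matrix.mul_assoc]
  abel

theorem exists_eventually_smul_one_le_crossMoment [DecidableEq R] {X : Type*} {l : Filter X}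
    {n : X → ℕ} {φ : X → ℕ → R → ℝ} {u : X → ℕ → ι → ℝ} {Γ : Matrix ι ι ℝ} {m : ℕ}
    (hrec : ∀ p c, φ p (c + 1) = F *ᵥ φ p c + L *ᵥ u p c) (hFL : IsReachable m F L)
    (hΓ : Γ.PosDef) (huu : Tendsto (fun p => crossMoment (n p) (u p) (u p)) l (𝓝 Γ))
    (huφ : Tendsto (fun p => crossMoment (n p) (u p) (φ p)) l (𝓝 0))
    (hlast : Tendsto (fun p => (√(n p))⁻¹ • φ p (n p)) l (𝓝 0)) :
    ∃ c > (0 : ℝ), ∀ᶠ p in l, c • (1 : Matrix R R ℝ) ≤ crossMoment (n p) (φ p) (φ p) := by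
  let G (p : X) := crossMoment (n p) (φ p) (φ p)
  let G' (p : X) := crossMoment (n p) (fun c => φ p (c + 1)) (fun c => φ p (c + 1))
  let w (p : X) := (√(n p))⁻¹ • φ p (n p)
  let D (p : X) := G' p - Matrix.vecMulVec (w p) (w p) - F * G p * Fᵀ
  have hD : Tendsto D l (𝓝 (L * Γ * Lᵀ)) := by
    have hDeq (p : X) : D p = F * (crossMoment (n p) (u p) (φ p))ᵀ * Lᵀ +
        L * crossMoment (n p) (u p) (φ p) * Fᵀ + L * crossMoment (n p) (u p) (u p) * Lᵀ -
          Matrix.vecMulVec (w p) (w p) := by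
      simp only [D, G, G', crossMoment_shift_self_eq (hrec p)]
      abel
    have hcont : Continuous fun q : Matrix ι R ℝ × Matrix ι ι ℝ × (R → ℝ) =>
        F * q.1ᵀ * Lᵀ + L * q.1 * Fᵀ + L * q.2.1 * Lᵀ - Matrix.vecMulVec q.2.2 q.2.2 := by
      fun_prop
    have h := (hcont.tendsto (0, Γ, 0)).comp (huφ.prodMk_nhds (huu.prodMk_nhds hlast))
    simp only [Matrix.transpose_zero, Matrix.mul_zero, Matrix.zero_mul, zero_add,
      Matrix.zero_vecMulVec, sub_zero] at h
    exact h.congr fun p => (hDeq p).symm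
  have hG (p : X) : 0 ≤ G p := (posSemidef_crossMoment_self _ _).nonneg
  have hle (p : X) : gramian m F (D p) ≤ G p := by
    refine gramian_le (hG p) ?_ m
    rw [Matrix.star_eq_conjTranspose, Matrix.conjTranspose_eq_transpose_of_trivial,
      add_sub_cancel, sub_le_iff_le_add]
    exact crossMoment_shift_self_le _ _
  have hDself (p : X) : IsSelfAdjoint (D p) :=
    ((posSemidef_crossMoment_self _ _).isHermitian.isSelfAdjoint.sub
      (Matrix.posSemidef_vecMulVec_self_star _).isHermitian.isSelfAdjoint).sub
        ((IsSelfAdjoint.of_nonneg (hG p)).conjugate F)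
  obtain ⟨c, hc, hnear⟩ := exists_eventually_smul_one_le (hFL.posDef_gramian hΓ)
  exact ⟨c, hc, (((continuous_gramian m F).tendsto _).comp hD |>.eventually hnear).mono
    fun p hp => (hp (isSelfAdjoint_gramian (hDself p) m F)).trans (hle p)⟩

end CrossMoment

section VanishingCrossMoment

variable {ι κ X : Type*} {l : Filter X} {n : X → ℕ}

theorem crossMoment_add_right (n : ℕ) (u : ℕ → ι → ℝ) (φ ψ : ℕ → κ → ℝ) :
    crossMoment n u (φ + ψ) = crossMoment n u φ + crossMoment n u ψ := by
  ext a r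
  simp only [crossMoment_apply, Matrix.add_apply, Pi.add_apply, mul_add, Finset.sum_add_distrib,
    add_div]

theorem sq_crossMoment_apply_le (n : ℕ) (u : ℕ → ι → ℝ) (φ : ℕ → κ → ℝ) (a : ι) (r : κ) :
    crossMoment n u φ a r ^ 2 ≤ crossMoment n u u a a * crossMoment n φ φ r r := by
  simp only [crossMoment_apply, div_pow, div_mul_div_comm, ← sq]
  gcongr
  exact Finset.sum_mul_sq_le_sq_mul_sq _ _ _

theorem tendsto_crossMoment_of_tendsto_self {u : X → ℕ → ι → ℝ} {φ : X → ℕ → κ → ℝ}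
    {Γ : Matrix ι ι ℝ} (hu : Tendsto (fun p => crossMoment (n p) (u p) (u p)) l (𝓝 Γ))
    (hφ : Tendsto (fun p => crossMoment (n p) (φ p) (φ p)) l (𝓝 0)) :
    Tendsto (fun p => crossMoment (n p) (u p) (φ p)) l (𝓝 0) := by
  refine tendsto_pi_nhds.2 fun a => tendsto_pi_nhds.2 fun r => ?_
  have hua := tendsto_pi_nhds.1 (tendsto_pi_nhds.1 hu a) a
  have hφr := tendsto_pi_nhds.1 (tendsto_pi_nhds.1 hφ r) r
  have hsq := squeeze_zero (fun p => sq_nonneg _)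
    (fun p => sq_crossMoment_apply_le (n p) (u p) (φ p) a r) (by simpa using hua.mul hφr)
  simpa [Real.sqrt_sq_eq_abs, tendsto_zero_iff_abs_tendsto_zero, Function.comp_def] using hsq.sqrt

theorem tendsto_crossMoment_of_tendsto_zero {u : ℕ → ι → ℝ} {φ : ℕ → κ → ℝ}
    (hu : Tendsto u atTop (𝓝 0)) (hφ : Tendsto φ atTop (𝓝 0)) :
    Tendsto (fun n => crossMoment n u φ) atTop (𝓝 0) := by
  refine tendsto_pi_nhds.2 fun a => tendsto_pi_nhds.2 fun r => ?_
  have h := (tendsto_pi_nhds.1 hu a).mul (tendsto_pi_nhds.1 hφ r)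
  simpa [crossMoment_apply, div_eq_inv_mul] using h.cesaro

end VanishingCrossMoment

section LeastSquares

theorem pinv_mul_mul_transpose {p q : Type*} [Fintype p] [Fintype q] (M : Matrix p q ℝ) :
    pinv M * M * Mᵀ = Mᵀ := by
  obtain ⟨hMXM, -, -, hXM⟩ := pinv_spec M
  rw [← hXM, ← Matrix.transpose_mul, ← Matrix.mul_assoc, hMXM]

variable {ι R : Type*} [Fintype R]

theorem leastSquares_error_mul_crossMoment {Θ : Matrix ι R ℝ} {φ : ℕ → R → ℝ} {y u : ℕ → ι → ℝ}
    (hy : ∀ c, y c = Θ *ᵥ φ c + u c) (n : ℕ) :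
    (dataMatrix n y * pinv (dataMatrix n φ) - Θ) * crossMoment n φ φ = crossMoment n u φ := by
  have hdata : dataMatrix n y = Θ * dataMatrix n φ + dataMatrix n u := by
    ext a c
    simp [dataMatrix, hy, Matrix.mulVec, dotProduct, Matrix.mul_apply]
  have hnormal : dataMatrix n y * pinv (dataMatrix n φ) * dataMatrix n φ * (dataMatrix n φ)ᵀ =
      dataMatrix n y * (dataMatrix n φ)ᵀ := by
    rw [Matrix.mul_assoc, Matrix.mul_assoc, ← Matrix.mul_assoc (pinv _), pinv_mul_mul_transpose]
  rw [crossMoment, crossMoment, Matrix.mul_smul, ← Matrix.mul_assoc, Matrix.sub_mul, Matrix.sub_mul,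
    hnormal, hdata, Matrix.add_mul, add_sub_cancel_left]

theorem sq_mul_dotProduct_self_le [DecidableEq R] {G : Matrix R R ℝ} {c : ℝ} (hc : 0 ≤ c)
    (hG : c • 1 ≤ G) (e : R → ℝ) : c ^ 2 * (e ⬝ᵥ e) ≤ (e ᵥ* G) ⬝ᵥ (e ᵥ* G) := by
  have hquad : c * (e ⬝ᵥ e) ≤ (e ᵥ* G) ⬝ᵥ e := by
    have h := (Matrix.le_iff.1 hG).dotProduct_mulVec_nonneg e
    rw [star_trivial, Matrix.dotProduct_mulVec, Matrix.vecMul_sub, sub_dotProduct] at h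
    simpa [Matrix.vecMul_smul] using h
  have hsq := dotProduct_star_self_nonneg (e ᵥ* G - c • e)
  simp only [star_trivial, sub_dotProduct, dotProduct_sub, smul_dotProduct, dotProduct_smul,
    smul_eq_mul, dotProduct_comm e (e ᵥ* G)] at hsq
  nlinarith

theorem tendsto_zero_of_mul_eq [DecidableEq R] {X : Type*} {l : Filter X} {E S : X → Matrix ι R ℝ}
    {G : X → Matrix R R ℝ} {c : ℝ} (hc : 0 < c) (hG : ∀ᶠ p in l, c • 1 ≤ G p)
    (hE : ∀ p, E p * G p = S p) (hS : Tendsto S l (𝓝 0)) : Tendsto E l (𝓝 0) := by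
  refine tendsto_pi_nhds.2 fun a => tendsto_pi_nhds.2 fun r => ?_
  have hrow : Tendsto (fun p => √(S p a ⬝ᵥ S p a) / c) l (𝓝 0) := by
    have hcont : Continuous fun S : Matrix ι R ℝ => √(S a ⬝ᵥ S a) / c := by fun_prop
    have hzero : (0 : Matrix ι R ℝ) a = 0 := rfl
    exact (hcont.tendsto' 0 0 (by simp [hzero])).comp hS
  refine squeeze_zero_norm' (hG.mono fun p hp => ?_) hrow
  rw [le_div_iff₀' hc]
  refine Real.le_sqrt_of_sq_le ?_
  calc (c * ‖E p a r‖) ^ 2 = c ^ 2 * (E p a r * E p a r) := by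
        rw [mul_pow, Real.norm_eq_abs, sq_abs, sq (E p a r)]
    _ ≤ c ^ 2 * (E p a ⬝ᵥ E p a) := by
        gcongr
        exact Finset.single_le_sum (f := fun r => E p a r * E p a r)
          (fun _ _ => mul_self_nonneg _) (Finset.mem_univ r)
    _ ≤ S p a ⬝ᵥ S p a := hE p ▸ sq_mul_dotProduct_self_le hc.le hp (E p a)

end LeastSquares

section AutoRegression

variable {ι : Type*} {t : ℕ}

/-- The vector `[y(k); y(k-1); …; y(k-τ+1)]` of the last `τ` values of `y`, with truncated
subtraction of times. -/
def lagVec (τ : ℕ) (y : ℕ → ι → ℝ) (k : ℕ) : Fin τ × ι → ℝ :=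
  fun r => y (k - r.1) r.2

theorem tendsto_lagVec {τ k : ℕ} {y : ℕ → ι → ℝ} {a : ι → ℝ} (hy : Tendsto y atTop (𝓝 a)) :
    Tendsto (fun c => lagVec τ y (k + c)) atTop (𝓝 fun r => a r.2) := by
  refine tendsto_pi_nhds.2 fun r => tendsto_pi_nhds.1 (hy.comp ?_) r.2
  exact (tendsto_sub_atTop_nat r.1).comp (tendsto_atTop_mono (Nat.le_add_left · k) tendsto_id)

/-- The block row `[B₀ B₁ ⋯]` of auto-regressive coefficients. -/
def coeffRow {τ : ℕ} (B : Fin τ → Matrix ι ι ℝ) : Matrix ι (Fin τ × ι) ℝ :=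
  Matrix.of fun a r => B r.1 a r.2

theorem coeffRow_mulVec_lagVec [Fintype ι] {τ : ℕ} (B : Fin τ → Matrix ι ι ℝ) (y : ℕ → ι → ℝ)
    (k : ℕ) : coeffRow B *ᵥ lagVec τ y k = ∑ i, B i *ᵥ y (k - i) := by
  ext a
  simp [coeffRow, lagVec, Matrix.mulVec, dotProduct, Fintype.sum_prod_type]

variable [DecidableEq ι]

/-- The block companion matrix with first block row `Θ`; its block row `i + 1` selects block `i`, so
that it shifts lag vectors. -/
def companion (Θ : Matrix ι (Fin (t + 1) × ι) ℝ) : Matrix (Fin (t + 1) × ι) (Fin (t + 1) × ι) ℝ :=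
  Matrix.of fun r => Fin.cases (Θ r.2) (fun i => Pi.single (i.castSucc, r.2) 1) r.1

/-- The inclusion `[I; 0; …; 0]` of the leading block, through which the noise enters the companion
form. -/
def leadInput (t : ℕ) (ι : Type*) [DecidableEq ι] : Matrix (Fin (t + 1) × ι) ι ℝ :=
  (1 : Matrix (Fin (t + 1) × ι) (Fin (t + 1) × ι) ℝ).submatrix id (Prod.mk 0)

variable [Fintype ι]

theorem lagVec_succ {Θ : Matrix ι (Fin (t + 1) × ι) ℝ} {y : ℕ → ι → ℝ} {k : ℕ} {u : ι → ℝ}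
    (h : y (k + 1) = Θ *ᵥ lagVec (t + 1) y k + u) :
    lagVec (t + 1) y (k + 1) = companion Θ *ᵥ lagVec (t + 1) y k + leadInput t ι *ᵥ u := by
  ext ⟨i, b⟩
  cases i using Fin.cases with
  | zero =>
    simp [lagVec, h, companion, leadInput, Matrix.mulVec, dotProduct, Matrix.one_apply]
  | succ i =>
    simp [lagVec, companion, leadInput, Matrix.mulVec, dotProduct, Pi.single_apply]

theorem vecMul_companion_castSucc (Θ : Matrix ι (Fin (t + 1) × ι) ℝ) (v : Fin (t + 1) × ι → ℝ)
    (i : Fin t) (b : ι) :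
    (v ᵥ* companion Θ) (i.castSucc, b) =
      ∑ a, v (0, a) * Θ a (i.castSucc, b) + v (i.succ, b) := by
  simp [companion, Matrix.vecMul, dotProduct, Fintype.sum_prod_type, Fin.sum_univ_succ,
    Pi.single_apply, ite_and]

theorem isReachable_companion (Θ : Matrix ι (Fin (t + 1) × ι) ℝ) :
    IsReachable (t + 1) (companion Θ) (leadInput t ι) := by
  intro v hv
  have hlead (j : ℕ) (hj : j < t + 1) (b : ι) : (v ᵥ* companion Θ ^ j) (0, b) = 0 := by
    have h := congrFun (hv j hj) b
    rw [← Matrix.vecMul_vecMul] at h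
    simpa [leadInput, Matrix.vecMul, dotProduct, Matrix.one_apply] using h
  have hblock (i : Fin (t + 1)) :
      ∀ j, i + j < t + 1 → ∀ b, (v ᵥ* companion Θ ^ j) (i, b) = 0 := by
    induction i using Fin.induction with
    | zero => exact fun j hj => hlead j (by simpa using hj)
    | succ i ih =>
      intro j hj b
      have hshift := vecMul_companion_castSucc Θ (v ᵥ* companion Θ ^ j) i b
      rw [Matrix.vecMul_vecMul, ← pow_succ] at hshift
      simp only [Fin.val_succ] at hj
      simpa [ih (j + 1) (by simp; omega), hlead j (by omega)] using hshift.symm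
  ext ⟨i, b⟩
  simpa using hblock i 0 i.2 b

end AutoRegression

section LeastSquaresAutoRegression

variable {nm t : ℕ}

theorem lsar_eq (τ N : ℕ) (y : ℕ → Fin nm → ℝ) :
    lsar τ N y = dataMatrix (N - τ) (fun c => y (τ + 1 + c)) *
      pinv (dataMatrix (N - τ) fun c => lagVec τ y (τ + c)) :=
  rfl

theorem tendsto_lsarCoeff {X : Type*} {l : Filter X} {N : X → ℕ} {y u : X → ℕ → Fin nm → ℝ}
    {B : Fin (t + 1) → Matrix (Fin nm) (Fin nm) ℝ} {Γ : Matrix (Fin nm) (Fin nm) ℝ}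
    (hΓ : Γ.PosDef)
    (hAR : ∀ p k, t + 1 ≤ k → y p (k + 1) = ∑ i : Fin (t + 1), B i *ᵥ y p (k - i) + u p k)
    (huu : Tendsto (fun p => crossMoment (N p - (t + 1)) (fun c => u p (t + 1 + c))
      (fun c => u p (t + 1 + c))) l (𝓝 Γ))
    (huφ : Tendsto (fun p => crossMoment (N p - (t + 1)) (fun c => u p (t + 1 + c))
      (fun c => lagVec (t + 1) (y p) (t + 1 + c))) l (𝓝 0))
    (hlast : Tendsto (fun p => (√(N p - (t + 1) : ℕ))⁻¹ •
      lagVec (t + 1) (y p) (t + 1 + (N p - (t + 1)))) l (𝓝 0)) :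
    Tendsto (fun p => lsarCoeff (t + 1) (N p) (y p)) l (𝓝 B) := by
  have hreg (p : X) (c : ℕ) : y p (t + 1 + c + 1) =
      coeffRow B *ᵥ lagVec (t + 1) (y p) (t + 1 + c) + u p (t + 1 + c) := by
    rw [hAR p _ (by omega), coeffRow_mulVec_lagVec]
  have hrec (p : X) (c : ℕ) : lagVec (t + 1) (y p) (t + 1 + (c + 1)) =
      companion (coeffRow B) *ᵥ lagVec (t + 1) (y p) (t + 1 + c) +
        leadInput t (Fin nm) *ᵥ u p (t + 1 + c) := lagVec_succ (hreg p c)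
  obtain ⟨c, hc, hlow⟩ := exists_eventually_smul_one_le_crossMoment
    (φ := fun p c => lagVec (t + 1) (y p) (t + 1 + c)) (u := fun p c => u p (t + 1 + c))
    hrec (isReachable_companion (coeffRow B)) hΓ huu huφ hlast
  have herror (p : X) : (lsar (t + 1) (N p) (y p) - coeffRow B) *
      crossMoment (N p - (t + 1)) (fun c => lagVec (t + 1) (y p) (t + 1 + c))
        (fun c => lagVec (t + 1) (y p) (t + 1 + c)) =
      crossMoment (N p - (t + 1)) (fun c => u p (t + 1 + c))
        (fun c => lagVec (t + 1) (y p) (t + 1 + c)) := by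
    rw [lsar_eq]
    refine leastSquares_error_mul_crossMoment (fun c => ?_) _
    rw [← hreg, add_right_comm]
  have hlim := (tendsto_zero_of_mul_eq hc hlow herror huφ).add_const (coeffRow B)
  simp only [sub_add_cancel, zero_add] at hlim
  refine tendsto_pi_nhds.2 fun i => tendsto_pi_nhds.2 fun a => tendsto_pi_nhds.2 fun b => ?_
  exact tendsto_pi_nhds.1 (tendsto_pi_nhds.1 hlim a) (i, b)

end LeastSquaresAutoRegression

section ManifestAutoRegression

variable {nm nl : ℕ} (A : Matrix (Fin nm ⊕ Fin nl) (Fin nm ⊕ Fin nl) ℝ)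

/-- The coefficients `A₁₁, A₁₂ A₂₁, A₁₂ A₂₂ A₂₁, A₁₂ A₂₂² A₂₁, …` of the auto-regressive model
satisfied by the output once the latent nodes are eliminated. -/
def manifestCoeff : ℕ → Matrix (Fin nm) (Fin nm) ℝ
  | 0 => A.toBlocks₁₁
  | j + 1 => A.toBlocks₁₂ * A.toBlocks₂₂ ^ j * A.toBlocks₂₁

variable (x₀ : Fin nm ⊕ Fin nl → ℝ) (u : ℕ → Fin nm → ℝ)

/-- The latent part `x_l(k)` of the state. -/
def latent (k : ℕ) : Fin nl → ℝ :=
  fun i => state A x₀ u k (Sum.inr i)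

theorem output_succ (k : ℕ) : output A x₀ u (k + 1) =
    A.toBlocks₁₁ *ᵥ output A x₀ u k + A.toBlocks₁₂ *ᵥ latent A x₀ u k + u k := by
  ext i
  simp [output, latent, state, Matrix.mulVec, dotProduct, Matrix.toBlocks₁₁, Matrix.toBlocks₁₂]

theorem latent_succ (k : ℕ) : latent A x₀ u (k + 1) =
    A.toBlocks₂₁ *ᵥ output A x₀ u k + A.toBlocks₂₂ *ᵥ latent A x₀ u k := by
  ext i
  simp [output, latent, state, Matrix.mulVec, dotProduct, Matrix.toBlocks₂₁, Matrix.toBlocks₂₂]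

theorem latent_add (k m : ℕ) : latent A x₀ u (k + m) =
    ∑ j ∈ Finset.range m, (A.toBlocks₂₂ ^ j * A.toBlocks₂₁) *ᵥ output A x₀ u (k + m - (j + 1)) +
      A.toBlocks₂₂ ^ m *ᵥ latent A x₀ u k := by
  induction m with
  | zero => simp
  | succ m ih =>
    have hshift (j : ℕ) : A.toBlocks₂₂ *ᵥ (A.toBlocks₂₂ ^ j * A.toBlocks₂₁) *ᵥ
        output A x₀ u (k + m - (j + 1)) = (A.toBlocks₂₂ ^ (j + 1) * A.toBlocks₂₁) *ᵥ
          output A x₀ u (k + m + 1 - (j + 1 + 1)) := by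
      rw [Matrix.mulVec_mulVec, ← Matrix.mul_assoc, ← pow_succ', Nat.add_sub_add_right]
    rw [← add_assoc, latent_succ, ih, Finset.sum_range_succ', Matrix.mulVec_add,
      Matrix.mulVec_sum, Matrix.mulVec_mulVec, ← pow_succ']
    simp only [hshift, pow_zero, Matrix.one_mul, zero_add, Nat.add_sub_cancel]
    abel

theorem output_succ_eq_sum {t : ℕ} (ht : A.toBlocks₂₂ ^ t = 0) {k : ℕ} (hk : t ≤ k) :
    output A x₀ u (k + 1) =
      ∑ i : Fin (t + 1), manifestCoeff A i *ᵥ output A x₀ u (k - i) + u k := by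
  obtain ⟨k, rfl⟩ := Nat.exists_eq_add_of_le' hk
  rw [output_succ, latent_add, ht, Matrix.zero_mulVec, add_zero, Fin.sum_univ_succ,
    Finset.sum_range, Matrix.mulVec_sum]
  simp [manifestCoeff, Matrix.mul_assoc]

end ManifestAutoRegression

section TransferFunctions

section SchurComplement

variable {m n R : Type*} [Fintype m] [Fintype n] [DecidableEq m] [DecidableEq n] [CommRing R]
  {A : Matrix m m R} {B : Matrix m n R} {C : Matrix n m R} {D V : Matrix n n R}

theorem isUnit_sub_mul_mul_of_isUnit_fromBlocks (hDV : D * V = 1)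
    (h : IsUnit (Matrix.fromBlocks A B C D)) : IsUnit (A - B * V * C) := by
  let : Invertible D := ⟨V, mul_eq_one_comm.1 hDV, hDV⟩
  have hV : ⅟D = V := rfl
  rw [← hV]
  exact Matrix.isUnit_fromBlocks_iff_of_invertible₂₂.1 h

theorem toBlocks₁₁_inv_fromBlocks (hDV : D * V = 1) (h : IsUnit (Matrix.fromBlocks A B C D)) :
    (Matrix.fromBlocks A B C D)⁻¹.toBlocks₁₁ = (A - B * V * C)⁻¹ := by
  let : Invertible D := ⟨V, mul_eq_one_comm.1 hDV, hDV⟩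
  have hV : ⅟D = V := rfl
  have hschur := isUnit_sub_mul_mul_of_isUnit_fromBlocks hDV h
  rw [← hV] at hschur ⊢
  let := h.invertible
  let := hschur.invertible
  rw [← Matrix.invOf_eq_nonsing_inv, ← Matrix.invOf_eq_nonsing_inv, Matrix.invOf_fromBlocks₂₂_eq,
    Matrix.toBlocks_fromBlocks₁₁]

end SchurComplement

theorem smul_one_sub_mul_sum_inv_pow_smul_pow {𝕜 R : Type*} [Field 𝕜] [Ring R] [Algebra 𝕜 R]
    {z : 𝕜} (hz : z ≠ 0) {d : R} {t : ℕ} (hd : d ^ t = 0) :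
    (z • 1 - d) * ∑ j ∈ Finset.range t, (z ^ (j + 1))⁻¹ • d ^ j = 1 := by
  have htelescope (j : ℕ) : (z • 1 - d) * ((z ^ (j + 1))⁻¹ • d ^ j) =
      (z ^ j)⁻¹ • d ^ j - (z ^ (j + 1))⁻¹ • d ^ (j + 1) := by
    rw [sub_mul, smul_mul_assoc, one_mul, smul_smul, mul_smul_comm, ← pow_succ', pow_succ' z,
      mul_inv, mul_inv_cancel_left₀ hz]
  rw [Finset.mul_sum, Finset.sum_congr rfl fun j _ => htelescope j, Finset.sum_range_sub', hd]
  simp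

theorem zPoint_ne_zero (θ : ℝ) : zPoint θ ≠ 0 :=
  Complex.exp_ne_zero _

theorem norm_zPoint (θ : ℝ) : ‖zPoint θ‖ = 1 := by
  rw [zPoint, mul_comm]
  exact Complex.norm_exp_ofReal_mul_I θ

theorem continuous_zPoint : Continuous zPoint := by
  unfold zPoint
  fun_prop

theorem SchurStable.isUnit_zPoint_smul_one_sub {ι : Type*} [Fintype ι] [DecidableEq ι]
    {M : Matrix ι ι ℝ} (hM : SchurStable M) (θ : ℝ) :
    IsUnit (zPoint θ • (1 : Matrix ι ι ℂ) - M.map (algebraMap ℝ ℂ)) := by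
  have hnorm : ‖zPoint θ‖₊ = 1 := NNReal.eq (norm_zPoint θ)
  have hlt : spectralRadius ℂ (M.map (algebraMap ℝ ℂ)) < ‖zPoint θ‖₊ := by
    rw [hnorm]
    exact hM
  have h := spectrum.mem_resolventSet_of_spectralRadius_lt hlt
  rwa [spectrum.mem_resolventSet_iff, Algebra.algebraMap_eq_smul_one] at h

section Manifest

variable {nm nl t : ℕ} {A : Matrix (Fin nm ⊕ Fin nl) (Fin nm ⊕ Fin nl) ℝ}

theorem smul_one_sub_map_eq_fromBlocks (A : Matrix (Fin nm ⊕ Fin nl) (Fin nm ⊕ Fin nl) ℝ) (z : ℂ) :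
    z • 1 - A.map (algebraMap ℝ ℂ) = Matrix.fromBlocks
      (z • 1 - A.toBlocks₁₁.map (algebraMap ℝ ℂ)) (-A.toBlocks₁₂.map (algebraMap ℝ ℂ))
      (-A.toBlocks₂₁.map (algebraMap ℝ ℂ)) (z • 1 - A.toBlocks₂₂.map (algebraMap ℝ ℂ)) := by
  ext (i | i) (j | j) <;>
    simp [Matrix.toBlocks₁₁, Matrix.toBlocks₁₂, Matrix.toBlocks₂₁, Matrix.toBlocks₂₂,
      Matrix.one_apply]

theorem arChar_manifestCoeff (A : Matrix (Fin nm ⊕ Fin nl) (Fin nm ⊕ Fin nl) ℝ) (t : ℕ) (θ : ℝ) :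
    arChar (fun i : Fin (t + 1) => manifestCoeff A i) θ =
      (zPoint θ • 1 - A.toBlocks₁₁.map (algebraMap ℝ ℂ)) - (-A.toBlocks₁₂.map (algebraMap ℝ ℂ)) *
        (∑ j ∈ Finset.range t, (zPoint θ ^ (j + 1))⁻¹ • A.toBlocks₂₂.map (algebraMap ℝ ℂ) ^ j) *
        (-A.toBlocks₂₁.map (algebraMap ℝ ℂ)) := by
  have hneg (X : Matrix (Fin nm) (Fin nl) ℂ) (V : Matrix (Fin nl) (Fin nl) ℂ)
      (Y : Matrix (Fin nl) (Fin nm) ℂ) : -X * V * -Y = X * V * Y := by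
    rw [Matrix.neg_mul, Matrix.mul_neg, Matrix.neg_mul, neg_neg]
  rw [hneg, arChar, Fin.sum_univ_succ, Finset.sum_range, ← sub_sub]
  simp only [Fin.val_zero, pow_zero, inv_one, one_smul, manifestCoeff, Fin.val_succ,
    Matrix.mul_sum, Matrix.sum_mul, Matrix.map_mul, Matrix.map_pow, Matrix.mul_smul,
    Matrix.smul_mul]

theorem smul_one_sub_toBlocks₂₂_mul_sum (ht : A.toBlocks₂₂ ^ t = 0) (θ : ℝ) :
    (zPoint θ • 1 - A.toBlocks₂₂.map (algebraMap ℝ ℂ)) *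
      ∑ j ∈ Finset.range t, (zPoint θ ^ (j + 1))⁻¹ • A.toBlocks₂₂.map (algebraMap ℝ ℂ) ^ j = 1 := by
  refine smul_one_sub_mul_sum_inv_pow_smul_pow (zPoint_ne_zero θ) ?_
  rw [← Matrix.map_pow, ht, Matrix.map_zero _ (map_zero _)]

theorem isUnit_arChar_manifestCoeff (hA : SchurStable A) (ht : A.toBlocks₂₂ ^ t = 0) (θ : ℝ) :
    IsUnit (arChar (fun i : Fin (t + 1) => manifestCoeff A i) θ) := by
  rw [arChar_manifestCoeff]
  refine isUnit_sub_mul_mul_of_isUnit_fromBlocks (smul_one_sub_toBlocks₂₂_mul_sum ht θ) ?_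
  exact smul_one_sub_map_eq_fromBlocks A _ ▸ hA.isUnit_zPoint_smul_one_sub θ

theorem arTF_manifestCoeff (hA : SchurStable A) (ht : A.toBlocks₂₂ ^ t = 0) (θ : ℝ) :
    arTF (fun i : Fin (t + 1) => manifestCoeff A i) θ = manifestTF A θ := by
  have hunit := smul_one_sub_map_eq_fromBlocks A _ ▸ hA.isUnit_zPoint_smul_one_sub θ
  rw [arTF, manifestTF, arChar_manifestCoeff, smul_one_sub_map_eq_fromBlocks,
    toBlocks₁₁_inv_fromBlocks (smul_one_sub_toBlocks₂₂_mul_sum ht θ) hunit]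

end Manifest

section Continuity

variable {nm τ : ℕ} {B : Fin τ → Matrix (Fin nm) (Fin nm) ℝ} {K : Set ℝ} {θ : ℝ}

theorem continuous_arChar :
    Continuous fun q : (Fin τ → Matrix (Fin nm) (Fin nm) ℝ) × ℝ => arChar q.1 q.2 := by
  have hz : Continuous fun q : (Fin τ → Matrix (Fin nm) (Fin nm) ℝ) × ℝ => zPoint q.2 :=
    continuous_zPoint.comp continuous_snd
  refine (hz.smul continuous_const).sub (continuous_finsetSum _ fun i _ => ?_)
  refine ((hz.pow _).inv₀ fun q => pow_ne_zero _ (zPoint_ne_zero _)).smul ?_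
  exact ((continuous_apply i).comp continuous_fst).matrix_map (continuous_algebraMap ℝ ℂ)

open scoped Matrix.Norms.L2Operator in
theorem eventually_isUnit_arChar (hB : IsUnit (arChar B θ)) :
    ∀ᶠ q : (Fin τ → Matrix (Fin nm) (Fin nm) ℝ) × ℝ in 𝓝 (B, θ), IsUnit (arChar q.1 q.2) :=
  continuous_arChar.continuousAt.eventually (Units.isOpen.mem_nhds hB)

theorem eventually_forall_isUnit_arChar (hK : IsCompact K) (hB : ∀ θ ∈ K, IsUnit (arChar B θ)) :
    ∀ᶠ C in 𝓝 B, ∀ θ ∈ K, IsUnit (arChar C θ) :=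
  hK.eventually_forall_of_forall_eventually fun θ hθ => eventually_isUnit_arChar (hB θ hθ)

theorem continuousAt_arTF (hB : IsUnit (arChar B θ)) :
    ContinuousAt (fun q : (Fin τ → Matrix (Fin nm) (Fin nm) ℝ) × ℝ => arTF q.1 q.2) (B, θ) := by
  have hdet : (arChar B θ).det ≠ 0 := ((Matrix.isUnit_iff_isUnit_det _).1 hB).ne_zero
  have hinv : ContinuousAt Ring.inverse (arChar B θ).det := by
    simpa only [Ring.inverse_eq_inv'] using continuousAt_inv₀ hdet
  exact ContinuousAt.comp (f := fun q : (Fin τ → Matrix (Fin nm) (Fin nm) ℝ) × ℝ => arChar q.1 q.2)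
    (continuousAt_matrix_inv _ hinv) continuous_arChar.continuousAt

theorem tendsto_arTF_apply (hB : IsUnit (arChar B θ)) (a b : Fin nm) :
    Tendsto (fun C => arTF C θ a b) (𝓝 B) (𝓝 (arTF B θ a b)) := by
  have h := (continuousAt_arTF hB).tendsto.comp
    ((continuous_id.prodMk continuous_const).tendsto' B (B, θ) rfl)
  exact ((continuous_apply b).comp (continuous_apply a)).continuousAt.tendsto.comp h

theorem tendsto_arTF_sub (hB : IsUnit (arChar B θ)) :
    Tendsto (fun q : (Fin τ → Matrix (Fin nm) (Fin nm) ℝ) × ℝ => arTF q.1 q.2 - arTF B q.2)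
      (𝓝 (B, θ)) (𝓝 0) := by
  have h := (continuousAt_arTF hB).tendsto
  have hθ := h.comp ((continuous_const.prodMk continuous_snd).tendsto' (B, θ) (B, θ) rfl)
  simpa using h.sub hθ

open scoped Matrix.Norms.L2Operator in
theorem tendsto_l2_opENorm_zero {n : Type*} [Fintype n] [DecidableEq n] :
    Tendsto (fun X : Matrix n n ℂ => ‖X‖ₑ) (𝓝 0) (𝓝 0) :=
  continuous_enorm.tendsto' 0 0 enorm_zero

theorem tendsto_hInfNorm_arTF_sub
    (hB : ∀ θ ∈ Set.Icc (-Real.pi) Real.pi, IsUnit (arChar B θ)) :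
    Tendsto (fun C => hInfNorm fun θ => arTF C θ - arTF B θ) (𝓝 B) (𝓝 0) := by
  refine ENNReal.tendsto_nhds_zero.2 fun ε hε => ?_
  refine Eventually.mono (isCompact_Icc.eventually_forall_of_forall_eventually fun θ hθ => ?_)
    fun C hC => iSup₂_le hC
  have hlim := tendsto_l2_opENorm_zero.comp (tendsto_arTF_sub (hB θ hθ))
  exact hlim.eventually_le_const hε

end Continuity

end TransferFunctions

section Stability

theorem summable_norm_pow_of_spectralRadius_lt_one {R : Type*} [NormedRing R] [NormedAlgebra ℂ R]
    [CompleteSpace R] {a : R} (ha : spectralRadius ℂ a < 1) : Summable fun n => ‖a ^ n‖ := by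
  obtain ⟨r, har, hr⟩ := ENNReal.lt_iff_exists_nnreal_btwn.1 ha
  refine (summable_geometric_of_lt_one r.2 (mod_cast hr)).of_norm_bounded_eventually_nat ?_
  filter_upwards [(spectrum.pow_nnnorm_pow_one_div_tendsto_nhds_spectralRadius a).eventually
    (gt_mem_nhds har), eventually_gt_atTop 0] with n hn hn0
  have hpow : (‖a ^ n‖₊ : ℝ≥0∞) ≤ r ^ n := by
    have h := ENNReal.rpow_le_rpow hn.le n.cast_nonneg
    rwa [← ENNReal.rpow_mul, one_div, inv_mul_cancel₀ (by positivity), ENNReal.rpow_one,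
      ENNReal.rpow_natCast] at h
  rw [norm_norm]
  exact_mod_cast hpow

variable {ι : Type*} [Fintype ι] [DecidableEq ι] {M : Matrix ι ι ℝ}

open scoped Matrix.Norms.L2Operator in
theorem SchurStable.summable_map_pow (hM : SchurStable M) :
    Summable fun k => M.map (algebraMap ℝ ℂ) ^ k :=
  (summable_norm_pow_of_spectralRadius_lt_one hM).of_norm

theorem SchurStable.summable_pow (hM : SchurStable M) : Summable fun k => M ^ k := by
  refine Pi.summable.2 fun i => Pi.summable.2 fun j => ?_
  have h := Complex.reCLM.summable (Pi.summable.1 (Pi.summable.1 hM.summable_map_pow i) j)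
  refine h.congr fun k => ?_
  rw [← Matrix.map_pow]
  rfl

theorem SchurStable.tendsto_pow_mulVec (hM : SchurStable M) (x : ι → ℝ) :
    Tendsto (fun k => M ^ k *ᵥ x) atTop (𝓝 0) := by
  have hcont : Continuous fun X : Matrix ι ι ℝ => X *ᵥ x := by fun_prop
  exact (hcont.tendsto' 0 0 (Matrix.zero_mulVec x)).comp hM.summable_pow.tendsto_atTop_zero

end Stability

section StateResponse

variable {nm nl : ℕ} (A : Matrix (Fin nm ⊕ Fin nl) (Fin nm ⊕ Fin nl) ℝ)

theorem state_zero_input (x₀ : Fin nm ⊕ Fin nl → ℝ) (k : ℕ) : state A x₀ 0 k = A ^ k *ᵥ x₀ := by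
  induction k with
  | zero => simp [state]
  | succ k ih => simp [state, ih, pow_succ']

theorem state_eq_add (x₀ : Fin nm ⊕ Fin nl → ℝ) (u : ℕ → Fin nm → ℝ) :
    state A x₀ u = state A 0 u + state A x₀ 0 := by
  funext k
  induction k with
  | zero => simp [state]
  | succ k ih =>
    rw [Pi.add_apply, state, ih, state, state, Pi.add_apply, Matrix.mulVec_add]
    simp only [Pi.zero_apply, Sum.elim_zero_zero, add_zero]
    abel

theorem output_eq_add (x₀ : Fin nm ⊕ Fin nl → ℝ) (u : ℕ → Fin nm → ℝ) :
    output A x₀ u = output A 0 u + output A x₀ 0 := by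
  funext k a
  exact congrFun (congrFun (state_eq_add A x₀ u) k) (Sum.inl a)

theorem state_zero_eq_sum (u : ℕ → Fin nm → ℝ) (k : ℕ) :
    state A 0 u k = ∑ j ∈ Finset.range k, A ^ j *ᵥ Sum.elim (u (k - (j + 1))) 0 := by
  induction k with
  | zero => simp [state]
  | succ k ih =>
    rw [state, ih, Finset.sum_range_succ', Matrix.mulVec_sum]
    simp [Matrix.mulVec_mulVec, ← pow_succ']

theorem state_zero_apply (u : ℕ → Fin nm → ℝ) (k : ℕ) (i : Fin nm ⊕ Fin nl) :
    state A 0 u k i = ∑ q ∈ Finset.range k ×ˢ (Finset.univ : Finset (Fin nm)),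
      (A ^ q.1) i (Sum.inl q.2) * u (k - (q.1 + 1)) q.2 := by
  rw [state_zero_eq_sum, Finset.sum_apply, Finset.sum_product]
  simp [Matrix.mulVec, dotProduct]

variable {A}

theorem SchurStable.exists_sum_abs_impulseResponse_le (hA : SchurStable A) (i : Fin nm ⊕ Fin nl) :
    ∃ C, ∀ k, ∑ q ∈ Finset.range k ×ˢ (Finset.univ : Finset (Fin nm)),
      |(A ^ q.1) i (Sum.inl q.2)| ≤ C := by
  have hsum (a : Fin nm) : Summable fun j => |(A ^ j) i (Sum.inl a)| :=
    (Pi.summable.1 (Pi.summable.1 hA.summable_pow i) (Sum.inl a)).abs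
  refine ⟨∑ a, ∑' j, |(A ^ j) i (Sum.inl a)|, fun k => ?_⟩
  rw [Finset.sum_product_right]
  exact Finset.sum_le_sum fun a _ => (hsum a).sum_le_tsum _ fun _ _ => abs_nonneg _

theorem SchurStable.tendsto_output_zero_input (hA : SchurStable A) (x₀ : Fin nm ⊕ Fin nl → ℝ) :
    Tendsto (output A x₀ 0) atTop (𝓝 0) := by
  refine tendsto_pi_nhds.2 fun a => ?_
  simpa only [output, state_zero_input, Pi.zero_apply] using
    tendsto_pi_nhds.1 (hA.tendsto_pow_mulVec x₀) (Sum.inl a)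

end StateResponse

section SecondMoments

variable {Ω : Type*} [MeasurableSpace Ω] {P : Measure Ω}

theorem integral_sq_sum_of_orthogonal {ι : Type*} {X : ι → Ω → ℝ} (hX : ∀ i, MemLp (X i) 2 P)
    (horth : Pairwise fun i j => ∫ s, X i s * X j s ∂P = 0) (S : Finset ι) :
    ∫ s, (∑ i ∈ S, X i s) ^ 2 ∂P = ∑ i ∈ S, ∫ s, X i s ^ 2 ∂P := by
  have hint (i j : ι) : Integrable (fun s => X i s * X j s) P := (hX i).integrable_mul (hX j)
  simp only [sq, Finset.sum_mul_sum]
  rw [integral_finsetSum _ fun i _ => integrable_finsetSum _ fun j _ => hint i j]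
  refine Finset.sum_congr rfl fun i hi => ?_
  rw [integral_finsetSum _ fun j _ => hint i j]
  exact Finset.sum_eq_single_of_mem i hi fun j _ hj => horth hj.symm

theorem integral_sq_sum_mul_le {ι : Type*} {X : ι → Ω → ℝ} {D : ℝ} (hX : ∀ i, MemLp (X i) 2 P)
    (hD : ∀ i, ∫ s, X i s ^ 2 ∂P ≤ D) (w : ι → ℝ) (S : Finset ι) :
    ∫ s, (∑ i ∈ S, w i * X i s) ^ 2 ∂P ≤ (∑ i ∈ S, |w i|) ^ 2 * D := by
  have hint (i : ι) : Integrable (fun s => |w i| * X i s ^ 2) P := (hX i).integrable_sq.const_mul _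
  calc ∫ s, (∑ i ∈ S, w i * X i s) ^ 2 ∂P
      ≤ ∫ s, (∑ i ∈ S, |w i|) * ∑ i ∈ S, |w i| * X i s ^ 2 ∂P := by
        refine integral_mono (memLp_finsetSum S fun i _ => (hX i).const_mul (w i)).integrable_sq
          ((integrable_finsetSum _ fun i _ => hint i).const_mul _) fun s => ?_
        refine Finset.sum_sq_le_sum_mul_sum_of_sq_le_mul _ (fun _ _ => abs_nonneg _)
          (fun i _ => by positivity) fun i _ => ?_
        rw [mul_pow, ← mul_assoc, ← sq, sq_abs]
    _ = (∑ i ∈ S, |w i|) * ∑ i ∈ S, |w i| * ∫ s, X i s ^ 2 ∂P := by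
        rw [integral_const_mul, integral_finsetSum _ fun i _ => hint i]
        simp only [integral_const_mul]
    _ ≤ (∑ i ∈ S, |w i|) * ∑ i ∈ S, |w i| * D := by gcongr with i; exact hD i
    _ = (∑ i ∈ S, |w i|) ^ 2 * D := by rw [← Finset.sum_mul, sq, mul_assoc]

variable {X : ℕ → Ω → ℝ} {C : ℝ}

theorem tendsto_inMeasure_average_of_orthogonal (hX : ∀ n, MemLp (X n) 2 P)
    (horth : Pairwise fun m n => ∫ s, X m s * X n s ∂P = 0) (hC : ∀ n, ∫ s, X n s ^ 2 ∂P ≤ C) :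
    Tendsto (fun q : ℕ × Ω => (∑ c ∈ Finset.range q.1, X c q.2) / q.1) (inMeasure P atTop)
      (𝓝 0) := by
  refine tendsto_inMeasure_of_tendsto_integral_sq
    (f := fun n s => (∑ c ∈ Finset.range n, X c s) / n) (fun n => ?_) ?_
  · simp only [div_eq_inv_mul]
    exact (memLp_finsetSum _ fun c _ => hX c).const_mul _
  · refine squeeze_zero (fun n => integral_nonneg fun s => sq_nonneg _) (fun n => ?_)
      (tendsto_const_div_atTop_nhds_zero_nat C)
    simp only [div_pow, integral_div, integral_sq_sum_of_orthogonal hX horth]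
    calc (∑ c ∈ Finset.range n, ∫ s, X c s ^ 2 ∂P) / (n : ℝ) ^ 2 ≤ n * C / (n : ℝ) ^ 2 := by
          gcongr
          simpa using Finset.sum_le_card_nsmul (Finset.range n) _ C fun c _ => hC c
      _ = C / n := by
          rcases eq_or_ne n 0 with rfl | hn
          · simp
          · field_simp

theorem tendsto_inMeasure_inv_sqrt_mul (hX : ∀ n, MemLp (X n) 2 P)
    (hC : ∀ n, ∫ s, X n s ^ 2 ∂P ≤ C) :
    Tendsto (fun q : ℕ × Ω => (√q.1)⁻¹ * X q.1 q.2) (inMeasure P atTop) (𝓝 0) := by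
  refine tendsto_inMeasure_of_tendsto_integral_sq (f := fun (n : ℕ) s => (√n)⁻¹ * X n s)
    (fun n => (hX n).const_mul _) ?_
  refine squeeze_zero (fun n => integral_nonneg fun s => sq_nonneg _) (fun n => ?_)
    (tendsto_const_div_atTop_nhds_zero_nat C)
  simp only [mul_pow, inv_pow, Real.sq_sqrt (Nat.cast_nonneg (α := ℝ) n)]
  rw [integral_const_mul, div_eq_inv_mul]
  exact mul_le_mul_of_nonneg_left (hC n) (by positivity)

end SecondMoments

section Past

variable {Ω E : Type*} [mE : MeasurableSpace E] (u : ℕ → Ω → E)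

/-- The σ-algebra generated by `u(0), …, u(k-1)`. Unlike `Filtration.natural` it excludes the time
`k` itself, so that it is independent of `u(k)`. -/
@[reducible] def past (k : ℕ) : MeasurableSpace Ω :=
  ⨆ j ∈ Set.Iio k, mE.comap (u j)

theorem past_mono : Monotone (past u) :=
  fun _ _ h => biSup_mono fun _ => (Set.Iio_subset_Iio h ·)

theorem measurable_past {j k : ℕ} (h : j < k) : Measurable[past u k] (u j) :=
  (comap_measurable (u j)).mono (le_iSup₂ (f := fun j (_ : j ∈ Set.Iio k) => mE.comap (u j)) j h)
    le_rfl

variable {u} [mΩ : MeasurableSpace Ω]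

theorem past_le (hu : ∀ k, Measurable (u k)) (k : ℕ) : past u k ≤ mΩ :=
  iSup₂_le fun j _ => (hu j).comap_le

theorem indepFun_past {F : Type*} [MeasurableSpace F] {P : Measure Ω} (hu : ∀ k, Measurable (u k))
    (hind : iIndepFun u P) {k : ℕ} {f : Ω → F} (hf : Measurable[past u k] f) :
    IndepFun f (u k) P := by
  have h := indep_iSup_of_disjoint (fun j => (hu j).comap_le) ((iIndepFun_iff_iIndep _ _ _).1 hind)
    (S := Set.Iio k) (T := {k}) (Set.disjoint_singleton_right.2 (lt_irrefl k))
  rw [iSup_singleton] at h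
  exact (IndepFun_iff_Indep _ _ _).2 (indep_of_indep_of_le_left h hf.comap_le)

end Past

section CenteredIID

/-- A sequence of i.i.d., square integrable random vectors with zero mean and covariance matrix
`Γ`. -/
structure IsCenteredIID {Ω ι : Type*} [MeasurableSpace Ω] (P : Measure Ω) (u : ℕ → Ω → ι → ℝ)
    (Γ : Matrix ι ι ℝ) : Prop where
  measurable : ∀ k, Measurable (u k)
  indep : iIndepFun u P
  identDistrib : ∀ j k, IdentDistrib (u j) (u k) P P
  memLp : ∀ k a, MemLp (fun s => u k s a) 2 P
  mean : ∀ k a, ∫ s, u k s a ∂P = 0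
  cov : ∀ k a b, covariance (fun s => u k s a) (fun s => u k s b) P = Γ a b

variable {Ω : Type*} [MeasurableSpace Ω] {P : Measure Ω}

theorem IsWhiteInput.isCenteredIID {nm : ℕ} {u : ℕ → Ω → Fin nm → ℝ} (hu : IsWhiteInput P u) :
    IsCenteredIID P u 1 where
  measurable := hu.measurable
  indep := hu.indep
  identDistrib j k := (hu.identDistrib j).trans (hu.identDistrib k).symm
  memLp := hu.memLp
  mean := hu.mean
  cov := hu.cov

namespace IsCenteredIID

variable {ι : Type*} {u : ℕ → Ω → ι → ℝ} {Γ : Matrix ι ι ℝ} {k : ℕ} {f : Ω → ℝ}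

theorem indepFun_past_apply (hu : IsCenteredIID P u Γ) (hf : Measurable[past u k] f) (a : ι) :
    IndepFun f (fun s => u k s a) P :=
  (indepFun_past hu.measurable hu.indep hf).comp measurable_id (measurable_pi_apply a)

theorem indepFun_sq_past (hu : IsCenteredIID P u Γ) (hf : Measurable[past u k] f) (a : ι) :
    IndepFun (fun s => u k s a ^ 2) (fun s => f s ^ 2) P :=
  (hu.indepFun_past_apply hf a).symm.comp (measurable_id.pow_const 2) (measurable_id.pow_const 2)

theorem memLp_mul_past (hu : IsCenteredIID P u Γ) (hf : Measurable[past u k] f)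
    (hf2 : MemLp f 2 P) (a : ι) : MemLp (fun s => u k s a * f s) 2 P := by
  refine (memLp_two_iff_integrable_sq ((hu.memLp k a).1.mul hf2.1)).2 ?_
  convert! (hu.indepFun_sq_past hf a).integrable_mul (hu.memLp k a).integrable_sq
    hf2.integrable_sq using 2
  exact mul_pow _ _ _

theorem integral_mul_past (hu : IsCenteredIID P u Γ) (hf : Measurable[past u k] f) (a : ι) :
    ∫ s, f s * u k s a ∂P = 0 := by
  have h := (hu.indepFun_past_apply hf a).integral_mul_eq_mul_integral
    (hf.mono (past_le hu.measurable k) le_rfl).aestronglyMeasurable (hu.memLp k a).1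
  simpa [hu.mean] using h

variable [IsProbabilityMeasure P]

theorem integral_mul (hu : IsCenteredIID P u Γ) (k : ℕ) (a b : ι) :
    ∫ s, u k s a * u k s b ∂P = Γ a b := by
  rw [← hu.cov k a b, covariance_eq_sub (hu.memLp k a) (hu.memLp k b), hu.mean, zero_mul, sub_zero]
  rfl

theorem integral_sq (hu : IsCenteredIID P u Γ) (k : ℕ) (a : ι) :
    ∫ s, u k s a ^ 2 ∂P = Γ a a := by
  simpa only [sq] using hu.integral_mul k a a

theorem tendsto_crossMoment_self (hu : IsCenteredIID P u Γ) (k : ℕ) :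
    Tendsto (fun q : ℕ × Ω => crossMoment q.1 (fun c => u (k + c) q.2) (fun c => u (k + c) q.2))
      (inMeasure P atTop) (𝓝 Γ) := by
  refine tendsto_pi_nhds.2 fun a => tendsto_pi_nhds.2 fun b => ?_
  simp only [crossMoment_apply]
  have hm : Measurable fun x : ι → ℝ => x a * x b := by fun_prop
  have hlln := strong_law_ae_real (μ := P) (fun c s => u (k + c) s a * u (k + c) s b)
    ((hu.memLp _ a).integrable_mul (hu.memLp _ b))
    (fun i j hij => (hu.indep.indepFun ((add_right_injective k).ne hij)).comp hm hm)
    (fun i => (hu.identDistrib (k + i) (k + 0)).comp hm)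
  rw [hu.integral_mul] at hlln
  have hmeas := hu.measurable
  exact tendsto_inMeasure_of_tendsto_ae (f := fun n s =>
    (∑ c ∈ Finset.range n, u (k + c) s a * u (k + c) s b) / (n : ℝ)) (fun n => by fun_prop) hlln

theorem integral_sq_mul_past (hu : IsCenteredIID P u Γ) (hf : Measurable[past u k] f)
    (hf2 : MemLp f 2 P) (a : ι) :
    ∫ s, (u k s a * f s) ^ 2 ∂P = Γ a a * ∫ s, f s ^ 2 ∂P := by
  have h := (hu.indepFun_sq_past hf a).integral_mul_eq_mul_integral
    (hu.memLp k a).integrable_sq.1 hf2.integrable_sq.1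
  rw [hu.integral_sq] at h
  simpa only [Pi.mul_apply, mul_pow] using h

theorem tendsto_crossMoment_past (hu : IsCenteredIID P u Γ) (k : ℕ) {κ : Type*}
    {φ : ℕ → Ω → κ → ℝ} (hφ : ∀ c r, Measurable[past u (k + c)] fun s => φ c s r)
    (hφ2 : ∀ c r, MemLp (fun s => φ c s r) 2 P) {C : κ → ℝ}
    (hC : ∀ c r, ∫ s, φ c s r ^ 2 ∂P ≤ C r) :
    Tendsto (fun q : ℕ × Ω => crossMoment q.1 (fun c => u (k + c) q.2) (fun c => φ c q.2))
      (inMeasure P atTop) (𝓝 0) := by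
  refine tendsto_pi_nhds.2 fun a => tendsto_pi_nhds.2 fun r => ?_
  simp only [crossMoment_apply]
  refine tendsto_inMeasure_average_of_orthogonal (X := fun c s => u (k + c) s a * φ c s r)
    (C := Γ a a * C r) (fun c => hu.memLp_mul_past (hφ c r) (hφ2 c r) a) ?_ fun c => ?_
  · intro m n hmn
    wlog hlt : m < n generalizing m n
    · simpa only [mul_comm] using this hmn.symm (hmn.lt_or_gt.resolve_left hlt)
    have hpast : Measurable[past u (k + n)] fun s => u (k + m) s a * φ m s r * φ n s r :=
      (((measurable_pi_apply a).comp (measurable_past u (by omega))).mul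
        ((hφ m r).mono (past_mono u (by omega)) le_rfl)).mul (hφ n r)
    rw [← hu.integral_mul_past hpast a]
    congr 1 with s
    ring
  · rw [hu.integral_sq_mul_past (hφ c r) (hφ2 c r)]
    refine mul_le_mul_of_nonneg_left (hC c r) ?_
    rw [← hu.integral_sq 0 a]
    exact integral_nonneg fun s => sq_nonneg _

end IsCenteredIID

end CenteredIID

section NetworkResponse

variable {Ω : Type*} {nm nl : ℕ}
  {A : Matrix (Fin nm ⊕ Fin nl) (Fin nm ⊕ Fin nl) ℝ} {u : ℕ → Ω → Fin nm → ℝ}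

theorem measurable_past_output (A : Matrix (Fin nm ⊕ Fin nl) (Fin nm ⊕ Fin nl) ℝ)
    (u : ℕ → Ω → Fin nm → ℝ) (k : ℕ) (a : Fin nm) :
    Measurable[past u k] fun s => output A 0 (fun j => u j s) k a := by
  simp only [output, state_zero_apply]
  refine Finset.measurable_fun_sum _ fun q hq => Measurable.const_mul ?_ _
  have hq' := Finset.mem_range.1 (Finset.mem_product.1 hq).1
  exact (measurable_pi_apply q.2).comp (measurable_past u (by omega))

variable [MeasurableSpace Ω] {P : Measure Ω} {Γ : Matrix (Fin nm) (Fin nm) ℝ}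

theorem measurable_output_zero_input {x₀ : Ω → Fin nm ⊕ Fin nl → ℝ} (hx₀ : Measurable x₀) (k : ℕ)
    (a : Fin nm) : Measurable fun s => output A (x₀ s) 0 k a := by
  simp only [output, state_zero_input, Matrix.mulVec, dotProduct]
  fun_prop

namespace IsCenteredIID

theorem memLp_output (hu : IsCenteredIID P u Γ)
    (A : Matrix (Fin nm ⊕ Fin nl) (Fin nm ⊕ Fin nl) ℝ) (k : ℕ) (a : Fin nm) :
    MemLp (fun s => output A 0 (fun j => u j s) k a) 2 P := by
  simp only [output, state_zero_apply]
  exact memLp_finsetSum _ fun q _ => (hu.memLp _ q.2).const_mul _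

variable [IsProbabilityMeasure P]

theorem exists_integral_sq_output_le (hu : IsCenteredIID P u Γ) (hA : SchurStable A) (a : Fin nm) :
    ∃ C, ∀ k, ∫ s, output A 0 (fun j => u j s) k a ^ 2 ∂P ≤ C := by
  have hΓ (b : Fin nm) : 0 ≤ Γ b b := hu.integral_sq 0 b ▸ integral_nonneg fun s => sq_nonneg _
  have hD (b : Fin nm) : Γ b b ≤ Γ.trace :=
    Finset.single_le_sum (f := fun b => Γ b b) (fun b _ => hΓ b) (Finset.mem_univ b)
  obtain ⟨W, hW⟩ := hA.exists_sum_abs_impulseResponse_le (Sum.inl a)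
  refine ⟨W ^ 2 * Γ.trace, fun k => ?_⟩
  simp only [output, state_zero_apply]
  refine (integral_sq_sum_mul_le (X := fun (q : ℕ × Fin nm) s => u (k - (q.1 + 1)) s q.2)
    (fun q => hu.memLp _ q.2) (fun q => (hu.integral_sq _ q.2).trans_le (hD q.2)) _ _).trans ?_
  have htrace : 0 ≤ Γ.trace := Finset.sum_nonneg fun b _ => hΓ b
  gcongr
  exact hW k

variable {x₀ : Ω → Fin nm ⊕ Fin nl → ℝ}

theorem tendsto_crossMoment_lagVec_output (hu : IsCenteredIID P u Γ) (hA : SchurStable A)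
    (hx₀ : Measurable x₀) (τ k : ℕ) :
    Tendsto (fun q : ℕ × Ω => crossMoment q.1 (fun c => u (k + c) q.2)
      (fun c => lagVec τ (output A (x₀ q.2) fun j => u j q.2) (k + c))) (inMeasure P atTop)
      (𝓝 0) := by
  have hforced : Tendsto (fun q : ℕ × Ω => crossMoment q.1 (fun c => u (k + c) q.2)
      (fun c => lagVec τ (output A 0 fun j => u j q.2) (k + c))) (inMeasure P atTop) (𝓝 0) := by
    choose C hC using hu.exists_integral_sq_output_le hA
    exact hu.tendsto_crossMoment_past k
      (φ := fun c s => lagVec τ (output A 0 fun j => u j s) (k + c)) (C := fun r => C r.2)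
      (fun c r => (measurable_past_output A u _ r.2).mono (past_mono u (Nat.sub_le _ _)) le_rfl)
      (fun c r => hu.memLp_output A _ r.2) fun c r => hC r.2 _
  have hfree : Tendsto (fun q : ℕ × Ω => crossMoment q.1 (fun c => u (k + c) q.2)
      (fun c => lagVec τ (output A (x₀ q.2) 0) (k + c))) (inMeasure P atTop) (𝓝 0) := by
    refine tendsto_crossMoment_of_tendsto_self (hu.tendsto_crossMoment_self k) ?_
    refine tendsto_pi_nhds.2 fun r => tendsto_pi_nhds.2 fun r' => ?_
    refine tendsto_inMeasure_of_tendsto_ae (f := fun n s => crossMoment n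
      (fun c => lagVec τ (output A (x₀ s) 0) (k + c))
      (fun c => lagVec τ (output A (x₀ s) 0) (k + c)) r r') (fun n => ?_) (.of_forall fun s => ?_)
    · have hmeas := measurable_output_zero_input (A := A) hx₀
      simp only [crossMoment_apply, lagVec]
      fun_prop
    · have h := tendsto_lagVec (τ := τ) (k := k) (hA.tendsto_output_zero_input (x₀ s))
      exact tendsto_pi_nhds.1
        (tendsto_pi_nhds.1 (tendsto_crossMoment_of_tendsto_zero h h) r) r'
  have h := hforced.add hfree
  rw [add_zero] at h
  refine h.congr fun q => ?_
  rw [← crossMoment_add_right, output_eq_add A (x₀ q.2) fun j => u j q.2]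
  rfl

theorem tendsto_inv_sqrt_smul_lagVec_output (hu : IsCenteredIID P u Γ) (hA : SchurStable A)
    (hx₀ : Measurable x₀) (τ k : ℕ) :
    Tendsto (fun q : ℕ × Ω => (√q.1)⁻¹ • lagVec τ (output A (x₀ q.2) fun j => u j q.2) (k + q.1))
      (inMeasure P atTop) (𝓝 0) := by
  refine tendsto_pi_nhds.2 fun r => ?_
  obtain ⟨C, hC⟩ := hu.exists_integral_sq_output_le hA r.2
  have hforced := tendsto_inMeasure_inv_sqrt_mul (fun n => hu.memLp_output A (k + n - r.1) r.2)
    fun n => hC (k + n - r.1)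
  have hfree : Tendsto (fun q : ℕ × Ω => (√q.1)⁻¹ * output A (x₀ q.2) 0 (k + q.1 - r.1) r.2)
      (inMeasure P atTop) (𝓝 0) := by
    refine tendsto_inMeasure_of_tendsto_ae
      (f := fun (n : ℕ) s => (√n)⁻¹ * output A (x₀ s) 0 (k + n - r.1) r.2) (fun n => ?_)
      (.of_forall fun s => ?_)
    · exact ((measurable_output_zero_input hx₀ _ _).const_mul _).aestronglyMeasurable
    · have h := tendsto_pi_nhds.1
        (tendsto_lagVec (τ := τ) (k := k) (hA.tendsto_output_zero_input (x₀ s))) r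
      simpa [lagVec] using (tendsto_inv_atTop_zero.comp
        (Real.tendsto_sqrt_atTop.comp tendsto_natCast_atTop_atTop)).mul h
  have h := hforced.add hfree
  rw [add_zero] at h
  refine h.congr fun q => ?_
  rw [output_eq_add A (x₀ q.2) fun j => u j q.2]
  exact (mul_add _ _ _).symm

theorem tendsto_lsarCoeff_output (hu : IsCenteredIID P u Γ) (hΓ : Γ.PosDef) (hA : SchurStable A)
    (hx₀ : Measurable x₀) {t : ℕ} (ht : A.toBlocks₂₂ ^ t = 0) :
    Tendsto (fun q : ℕ × Ω => lsarCoeff (t + 1) q.1 (output A (x₀ q.2) fun k => u k q.2))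
      (inMeasure P atTop) (𝓝 fun i : Fin (t + 1) => manifestCoeff A i) := by
  have hN := tendsto_prodMap_inMeasure (P := P) (tendsto_sub_atTop_nat (t + 1))
  have huu := (hu.tendsto_crossMoment_self (t + 1)).comp hN
  have huφ := (hu.tendsto_crossMoment_lagVec_output hA hx₀ (t + 1) (t + 1)).comp hN
  have hlast := (hu.tendsto_inv_sqrt_smul_lagVec_output hA hx₀ (t + 1) (t + 1)).comp hN
  exact tendsto_lsarCoeff (N := fun q : ℕ × Ω => q.1) (u := fun q k => u k q.2)
    (y := fun q => output A (x₀ q.2) fun k => u k q.2) hΓ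
    (fun q k hk => output_succ_eq_sum A (x₀ q.2) (fun k => u k q.2) ht (Nat.le_of_succ_le hk))
    huu huφ hlast

end IsCenteredIID

end NetworkResponse

end LSAR

end

theorem mainTheorem4_general
    {Ω : Type*} [MeasurableSpace Ω] (P : Measure Ω) [IsProbabilityMeasure P]
    (nm nl : ℕ)
    (A : Matrix (Fin nm ⊕ Fin nl) (Fin nm ⊕ Fin nl) ℝ)
    (hA : LSAR.SchurStable A)
    (τ22 : ℕ) (hnil : A.toBlocks₂₂ ^ τ22 = 0)
    (Γ : Matrix (Fin nm) (Fin nm) ℝ) (hΓ : Γ.PosDef)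
    (um : ℕ → Ω → Fin nm → ℝ) (hum : LSAR.IsCenteredIID P um Γ)
    (x₀ : Ω → Fin nm ⊕ Fin nl → ℝ) (hx₀ : Measurable x₀)
    (y : Ω → ℕ → Fin nm → ℝ) (hy : ∀ s, y s = LSAR.output A (x₀ s) (fun k => um k s))
    (τ : ℕ) (hτ : τ22 + 1 ≤ τ) :
    Tendsto (fun N : ℕ => P {s | ∃ θ ∈ Set.Icc (-Real.pi) Real.pi,
        ¬ IsUnit (LSAR.arChar (LSAR.lsarCoeff τ N (y s)) θ)}) atTop (𝓝 0) ∧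
    (∀ θ ∈ Set.Icc (-Real.pi) Real.pi, ∀ a b : Fin nm,
      TendstoInMeasure P (fun (N : ℕ) s => LSAR.arTF (LSAR.lsarCoeff τ N (y s)) θ a b) atTop
        (fun _ => LSAR.manifestTF A θ a b)) ∧
    (∀ ε : ℝ≥0∞, 0 < ε →
      Tendsto (fun N : ℕ => P {s | ε ≤ LSAR.hInfNorm (fun θ =>
        LSAR.arTF (LSAR.lsarCoeff τ N (y s)) θ - LSAR.manifestTF A θ)}) atTop (𝓝 0)) := by
  obtain ⟨t, rfl⟩ := Nat.exists_eq_add_of_le' (Nat.one_le_of_lt hτ)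
  obtain rfl : y = fun s => LSAR.output A (x₀ s) fun k => um k s := funext hy
  have ht : A.toBlocks₂₂ ^ t = 0 := pow_eq_zero_of_le (Nat.le_of_succ_le_succ hτ) hnil
  have hlim := hum.tendsto_lsarCoeff_output hΓ hA hx₀ ht
  have hunit := LSAR.isUnit_arChar_manifestCoeff hA ht
  simp only [← LSAR.arTF_manifestCoeff hA ht]
  refine ⟨?_, fun θ _ a b => ?_, fun ε hε => ?_⟩
  · have h := hlim.eventually
      (LSAR.eventually_forall_isUnit_arChar (isCompact_Icc (a := -Real.pi) (b := Real.pi))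
        fun θ _ => hunit θ)
    simpa only [LSAR.eventually_inMeasure, not_forall, exists_prop] using h
  · exact LSAR.tendstoInMeasure_const_iff.2 ((LSAR.tendsto_arTF_apply (hunit θ) a b).comp hlim)
  · have h := hlim.eventually
      ((LSAR.tendsto_hInfNorm_arTF_sub fun θ _ => hunit θ).eventually (gt_mem_nhds hε))
    simpa only [LSAR.eventually_inMeasure, not_lt] using h

theorem mainTheorem4
    {Ω : Type*} [MeasurableSpace Ω] (P : Measure Ω) [IsProbabilityMeasure P]
    (nm nl : ℕ)
    (A : Matrix (Fin nm ⊕ Fin nl) (Fin nm ⊕ Fin nl) ℝ)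
    (hA : LSAR.SchurStable A)
    (hA22 : LSAR.SchurStable A.toBlocks₂₂)
    (τ22 : ℕ) (hτ22 : 1 ≤ τ22) (hnil : A.toBlocks₂₂ ^ τ22 = 0)
    (um : ℕ → Ω → Fin nm → ℝ) (hum : LSAR.IsWhiteInput P um)
    (x₀ : Ω → Fin nm ⊕ Fin nl → ℝ) (hx₀ : Measurable x₀)
    (y : Ω → ℕ → Fin nm → ℝ) (hy : ∀ s, y s = LSAR.output A (x₀ s) (fun k => um k s))
    (τ : ℕ) (hτ : τ22 + 1 ≤ τ) :
    -- with probability tending to one, the estimated transfer function exists on the unit circle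
    Tendsto (fun N : ℕ => P {s | ∃ θ ∈ Set.Icc (-Real.pi) Real.pi,
        ¬ IsUnit (LSAR.arChar (LSAR.lsarCoeff τ N (y s)) θ)}) atTop (𝓝 0) ∧
    -- entrywise convergence in probability at every frequency
    (∀ θ ∈ Set.Icc (-Real.pi) Real.pi, ∀ a b : Fin nm,
      TendstoInMeasure P (fun (N : ℕ) s => LSAR.arTF (LSAR.lsarCoeff τ N (y s)) θ a b) atTop
        (fun _ => LSAR.manifestTF A θ a b)) ∧
    -- convergence in probability in the `H_∞`-norm
    (∀ ε : ℝ≥0∞, 0 < ε →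
      Tendsto (fun N : ℕ => P {s | ε ≤ LSAR.hInfNorm (fun θ =>
        LSAR.arTF (LSAR.lsarCoeff τ N (y s)) θ - LSAR.manifestTF A θ)}) atTop (𝓝 0)) :=
  mainTheorem4_general P nm nl A hA τ22 hnil 1 Matrix.PosDef.one um hum.isCenteredIID x₀ hx₀ y hy τ
    hτ
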